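/- Let $(X,\mathcal B,\mu)$ be a standard non-atomic probability space, and let $\mathrm{Aut}$ be the group of invertible $\mu$-preserving transformations of $X$, where transformations that differ on a set of measure $0$ are identified. Equip $\mathrm{Aut}$ with the Halmos metric $$\rho(S,T)=\sum_{i=1}^\infty 2^{-i}\bigl(\mu(SA_i\,\Delta\, TA_i)+\mu(S^{-1}A_i\,\Delta\, T^{-1}A_i)\bigr),$$ where $\{A_i\}_{i\ge 1}$ is a fixed sequence of measurable sets that is dense in $\mathcal B$ with respect to the distance $\mu(B\,\Delta\, C)$. For a finite measurable partition $\xi=\{C_1,\dots,C_n\}$ put $H(\xi)=-\sum_{i=1}^n\mu(C_i)\ln\mu(C_i)$ (with $0\ln 0=0$). Let $L(j)$, $j\ge 1$, be a sequence of non-negative integers with $L(j)\to\infty$, and let $P_j=\{j,2j,\dots,L(j)j\}$. For $S\in\mathrm{Aut}$ define $$h_P(S)=\sup_\xi\ \limsup_{j\to\infty}\ \frac1{|P_j|}\,H\Bigl(\bigvee_{p\in P_j}S^p\xi\Bigr)\in[0,\infty],$$ where the supremum is over all finite measurable partitions $\xi$ of $X$. Theorem. The set $\{S\in\mathrm{Aut}:\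 h_P(S)=\infty\}$ is typical in $(\mathrm{Aut},\rho)$, i.e. its complement is a set of the first category (a countable union of nowhere dense sets). -/

import Mathlib

open MeasureTheory Filter Topology
open scoped symmDiff

noncomputable section

namespace PEntropy

variable {X : Type*} [MeasurableSpace X]

/-- Bijections of `X` that are measurable and `μ`-preserving in both directions. -/
def MPPerm (μ : Measure X) : Subgroup (Equiv.Perm X) where
  carrier := {e | MeasurePreserving (⇑e) μ μ ∧ MeasurePreserving (⇑e⁻¹) μ μ}
  one_mem' := ⟨MeasurePreserving.id μ, MeasurePreserving.id μ⟩
  mul_mem' := fun {a b} ha hb => by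
    refine ⟨ha.1.comp hb.1, ?_⟩
    rw [mul_inv_rev]
    exact hb.2.comp ha.2
  inv_mem' := fun {a} ha => ⟨ha.2, by rw [inv_inv]; exact ha.1⟩

/-- Identification of transformations that differ on a set of measure zero. -/
def aeCon (μ : Measure X) : Con (MPPerm μ) where
  r S T := ⇑S.1 =ᵐ[μ] ⇑T.1
  iseqv := ⟨fun _ => EventuallyEq.rfl, fun h => h.symm, fun h h' => h.trans h'⟩
  mul' := fun {a b c d} hab hcd => by
    have h1 : ⇑a.1 ∘ ⇑c.1 =ᵐ[μ] ⇑b.1 ∘ ⇑c.1 := c.2.1.quasiMeasurePreserving.ae_eq_comp hab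
    have h2 : ⇑b.1 ∘ ⇑c.1 =ᵐ[μ] ⇑b.1 ∘ ⇑d.1 := hcd.fun_comp _
    exact h1.trans h2

/-- The group `Aut` of automorphisms of the measure space `(X, μ)`, modulo null sets. -/
abbrev Aut (μ : Measure X) : Type _ := (aeCon μ).Quotient

/-- `A 0, A 1, …` is a sequence of measurable sets that is dense in the algebra of measurable sets
for the distance `μ (B ∆ C)`. -/
def IsDenseFamily (μ : Measure X) (A : ℕ → Set X) : Prop :=
  (∀ i, MeasurableSet (A i)) ∧
    ∀ B, MeasurableSet B → ∀ ε : ℝ, 0 < ε → ∃ i, μ.real (A i ∆ B) < ε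

/-- `μ (S B ∆ T B) + μ (S⁻¹ B ∆ T⁻¹ B)`. -/
def halmosTerm (μ : Measure X) (B : Set X) (S T : MPPerm μ) : ℝ :=
  μ.real ((⇑S.1 '' B) ∆ (⇑T.1 '' B)) + μ.real ((⇑(S⁻¹).1 '' B) ∆ (⇑(T⁻¹).1 '' B))

/-- The Halmos distance `∑ᵢ 2⁻ⁱ [μ (S Aᵢ ∆ T Aᵢ) + μ (S⁻¹ Aᵢ ∆ T⁻¹ Aᵢ)]`, with `A i` in the role of
`A_{i+1}`. -/
def halmosDist (μ : Measure X) (A : ℕ → Set X) (S T : MPPerm μ) : ℝ :=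
  ∑' i : ℕ, (1 / 2 : ℝ) ^ (i + 1) * halmosTerm μ (A i) S T

theorem image_eq_preimage_inv {μ : Measure X} (S : MPPerm μ) (B : Set X) :
    ⇑S.1 '' B = ⇑(S⁻¹).1 ⁻¹' B :=
  Equiv.image_eq_preimage_symm S.1 B

theorem image_inv_eq_preimage {μ : Measure X} (S : MPPerm μ) (B : Set X) :
    ⇑(S⁻¹).1 '' B = ⇑S.1 ⁻¹' B := by
  rw [image_eq_preimage_inv, inv_inv]

theorem aeCon_inv {μ : Measure X} {S T : MPPerm μ} (h : aeCon μ S T) :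
    ⇑(S⁻¹).1 =ᵐ[μ] ⇑(T⁻¹).1 := (aeCon μ).inv h

theorem halmosTerm_congr {μ : Measure X} (B : Set X) {S T S' T' : MPPerm μ}
    (hS : aeCon μ S S') (hT : aeCon μ T T') : halmosTerm μ B S T = halmosTerm μ B S' T' := by
  simp only [halmosTerm, image_eq_preimage_inv, inv_inv]
  have e1 : ⇑S.1 ⁻¹' B =ᵐ[μ] ⇑S'.1 ⁻¹' B := EventuallyEq.preimage hS B
  have e2 : ⇑T.1 ⁻¹' B =ᵐ[μ] ⇑T'.1 ⁻¹' B := EventuallyEq.preimage hT B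
  have e3 : ⇑(S⁻¹).1 ⁻¹' B =ᵐ[μ] ⇑(S'⁻¹).1 ⁻¹' B := EventuallyEq.preimage (aeCon_inv hS) B
  have e4 : ⇑(T⁻¹).1 ⁻¹' B =ᵐ[μ] ⇑(T'⁻¹).1 ⁻¹' B := EventuallyEq.preimage (aeCon_inv hT) B
  rw [measureReal_congr (e1.symmDiff e2), measureReal_congr (e3.symmDiff e4)]

theorem halmosTerm_nonneg {μ : Measure X} (B : Set X) (S T : MPPerm μ) :
    0 ≤ halmosTerm μ B S T := add_nonneg measureReal_nonneg measureReal_nonneg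

theorem halmosTerm_le {μ : Measure X} [IsProbabilityMeasure μ] (B : Set X) (S T : MPPerm μ) :
    halmosTerm μ B S T ≤ 2 := by
  have h1 : μ.real ((⇑S.1 '' B) ∆ (⇑T.1 '' B)) ≤ 1 := measureReal_le_one
  have h2 : μ.real ((⇑(S⁻¹).1 '' B) ∆ (⇑(T⁻¹).1 '' B)) ≤ 1 := measureReal_le_one
  unfold halmosTerm
  linarith

theorem halmosTerm_triangle {μ : Measure X} [IsProbabilityMeasure μ] (B : Set X)
    (S T R : MPPerm μ) : halmosTerm μ B S R ≤ halmosTerm μ B S T + halmosTerm μ B T R := by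
  have h1 := measureReal_symmDiff_le (μ := μ) (s := ⇑S.1 '' B) (t := ⇑T.1 '' B) (⇑R.1 '' B)
  have h2 := measureReal_symmDiff_le (μ := μ) (s := ⇑(S⁻¹).1 '' B) (t := ⇑(T⁻¹).1 '' B)
    (⇑(R⁻¹).1 '' B)
  unfold halmosTerm
  linarith

theorem halmos_summable {μ : Measure X} [IsProbabilityMeasure μ] (A : ℕ → Set X)
    (S T : MPPerm μ) : Summable fun i : ℕ => (1 / 2 : ℝ) ^ (i + 1) * halmosTerm μ (A i) S T := by
  have hg : Summable fun i : ℕ => (1 / 2 : ℝ) ^ i := summable_geometric_two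
  refine Summable.of_nonneg_of_le
    (fun i => mul_nonneg (by positivity) (halmosTerm_nonneg _ _ _)) (fun i => ?_) hg
  calc (1 / 2 : ℝ) ^ (i + 1) * halmosTerm μ (A i) S T
      ≤ (1 / 2 : ℝ) ^ (i + 1) * 2 :=
        mul_le_mul_of_nonneg_left (halmosTerm_le _ _ _) (by positivity)
    _ = (1 / 2 : ℝ) ^ i := by ring

theorem aeCon_of_halmosDist_eq_zero {μ : Measure X} [IsProbabilityMeasure μ]
    [StandardBorelSpace X] {A : ℕ → Set X} (hA : IsDenseFamily μ A) {S T : MPPerm μ}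
    (h : halmosDist μ A S T = 0) : aeCon μ S T := by
  have hz : ∀ i, halmosTerm μ (A i) S T = 0 := by
    have h0 := (halmos_summable A S T).hasSum
    rw [show (∑' i : ℕ, (1 / 2 : ℝ) ^ (i + 1) * halmosTerm μ (A i) S T) = 0 from h] at h0
    have h1 := (hasSum_zero_iff_of_nonneg
      (fun i => mul_nonneg (by positivity) (halmosTerm_nonneg _ _ _))).1 h0
    intro i
    have h2 := congrFun h1 i
    have h3 : ((1 / 2 : ℝ) ^ (i + 1)) ≠ 0 := by positivity
    simpa [h3] using h2
  have hz' : ∀ i, μ.real ((⇑S.1 ⁻¹' A i) ∆ (⇑T.1 ⁻¹' A i)) = 0 := by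
    intro i
    have h1 := hz i
    simp only [halmosTerm, image_inv_eq_preimage] at h1
    linarith [measureReal_nonneg (μ := μ) (s := (⇑S.1 ⁻¹' A i) ∆ (⇑T.1 ⁻¹' A i)),
      measureReal_nonneg (μ := μ) (s := (⇑S.1 '' A i) ∆ (⇑T.1 '' A i))]
  refine EventuallyEq.of_forall_separating_preimage MeasurableSet fun B hB => ?_
  rw [← measure_symmDiff_eq_zero_iff, ← measureReal_eq_zero_iff]
  refine le_antisymm (le_of_forall_pos_le_add fun ε hε => ?_) measureReal_nonneg
  obtain ⟨i, hi⟩ := hA.2 B hB (ε / 2) (by positivity)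
  have hm : MeasurableSet (A i ∆ B) := (hA.1 i).symmDiff hB
  have hS : μ.real ((⇑S.1 ⁻¹' A i) ∆ (⇑S.1 ⁻¹' B)) = μ.real (A i ∆ B) := by
    rw [← Set.preimage_symmDiff]
    exact S.2.1.measureReal_preimage hm.nullMeasurableSet
  have hT : μ.real ((⇑T.1 ⁻¹' A i) ∆ (⇑T.1 ⁻¹' B)) = μ.real (A i ∆ B) := by
    rw [← Set.preimage_symmDiff]
    exact T.2.1.measureReal_preimage hm.nullMeasurableSet
  have t1 := measureReal_symmDiff_le (μ := μ) (s := ⇑S.1 ⁻¹' B) (t := ⇑S.1 ⁻¹' A i) (⇑T.1 ⁻¹' B)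
  have t2 := measureReal_symmDiff_le (μ := μ) (s := ⇑S.1 ⁻¹' A i) (t := ⇑T.1 ⁻¹' A i)
    (⇑T.1 ⁻¹' B)
  rw [symmDiff_comm (⇑S.1 ⁻¹' B) (⇑S.1 ⁻¹' A i)] at t1
  linarith [hz' i]

/-- The Halmos metric on `Aut` given by a dense family of sets. -/
@[reducible]
def halmosMetric (μ : Measure X) [IsProbabilityMeasure μ] [StandardBorelSpace X]
    {A : ℕ → Set X} (hA : IsDenseFamily μ A) : MetricSpace (Aut μ) where
  dist S T := Con.liftOn₂ S T (halmosDist μ A) fun S T S' T' hS hT => by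
    simp only [halmosDist, halmosTerm_congr _ hS hT]
  dist_self S := by
    induction S using Con.induction_on with | _ S
    change halmosDist μ A S S = 0
    simp [halmosDist, halmosTerm]
  dist_comm S T := by
    induction S using Con.induction_on with | _ S
    induction T using Con.induction_on with | _ T
    change halmosDist μ A S T = halmosDist μ A T S
    simp only [halmosDist, halmosTerm, symmDiff_comm]
  dist_triangle S T R := by
    induction S using Con.induction_on with | _ S
    induction T using Con.induction_on with | _ T
    induction R using Con.induction_on with | _ R
    change halmosDist μ A S R ≤ halmosDist μ A S T + halmosDist μ A T R
    unfold halmosDist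
    rw [← (halmos_summable A S T).tsum_add (halmos_summable A T R)]
    refine (halmos_summable A S R).tsum_le_tsum (fun i => ?_)
      ((halmos_summable A S T).add (halmos_summable A T R))
    rw [← mul_add]
    exact mul_le_mul_of_nonneg_left (halmosTerm_triangle _ _ _ _) (by positivity)
  eq_of_dist_eq_zero {S T} h := by
    induction S using Con.induction_on with | _ S
    induction T using Con.induction_on with | _ T
    exact (Con.eq _).2 (aeCon_of_halmosDist_eq_zero hA h)

/-- A set is typical if its complement is of the first category. -/
def IsTypical {Y : Type*} [TopologicalSpace Y] (s : Set Y) : Prop := IsMeagre sᶜ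

/-- Entropy `-∑ μ (C) ln μ (C)` of the finite partition into the fibres `C` of a map `η`.
Finite measurable partitions are encoded by measurable maps to a finite set; some fibres may be
empty, and these contribute `0`. -/
def partEntropy (μ : Measure X) {ι : Type*} [Fintype ι] (η : X → ι) : ℝ :=
  ∑ i, Real.negMulLog (μ.real (η ⁻¹' {i}))

/-- The join `⋁_{p ∈ F} Sᵖ ξ`: the point `x` lies in the cell of `Sᵖ ξ` that is the image under
`Sᵖ` of the cell of `ξ` with label `ξ (S⁻ᵖ x)`. -/
def joinPartition {μ : Measure X} (S : MPPerm μ) (F : Finset ℤ) {k : ℕ} (ξ : X → Fin k) :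
    X → (F → Fin k) :=
  fun x p => ξ (((S ^ (p : ℤ))⁻¹).1 x)

/-- `H (⋁_{p ∈ F} Sᵖ ξ)` for `S ∈ Aut`. -/
def joinEntropy {μ : Measure X} (S : Aut μ) (F : Finset ℤ) {k : ℕ} (ξ : X → Fin k) : ℝ :=
  Con.liftOn S (fun S => partEntropy μ (joinPartition S F ξ)) fun S T h => by
    have key : joinPartition S F ξ =ᵐ[μ] joinPartition T F ξ := by
      have h1 : ∀ p : F, ∀ᵐ x ∂μ, ((S ^ (p : ℤ))⁻¹).1 x = ((T ^ (p : ℤ))⁻¹).1 x :=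
        fun p => (aeCon μ).inv ((aeCon μ).zpow (p : ℤ) h)
      filter_upwards [ae_all_iff.2 h1] with x hx
      funext p
      simp only [joinPartition, hx p]
    unfold partEntropy
    exact Finset.sum_congr rfl fun i _ => by rw [measureReal_congr (key.preimage {i})]

/-- `h_P (S) = sup_ξ limsup_j |P_j|⁻¹ H (⋁_{p ∈ P_j} Sᵖ ξ)`, the supremum being over all finite
measurable partitions `ξ`. -/
def pEntropy {μ : Measure X} (P : ℕ → Finset ℤ) (S : Aut μ) : EReal :=
  ⨆ (k : ℕ) (ξ : X → Fin k) (_ : Measurable ξ),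
    limsup (fun j => ((joinEntropy S (P j) ξ / ((P j).card : ℝ) : ℝ) : EReal)) atTop

/-- The progression `{j, 2j, …, L(j) j}`. -/
def progression (L : ℕ → ℕ) (j : ℕ) : Finset ℤ :=
  (Finset.Icc 1 (L j)).image fun n : ℕ => (n : ℤ) * (j : ℤ)

end PEntropy

end

/-! For each M fix one partition ξ with H(ξ) > M. The set of S whose normalized join entropy exceeds
M for some j ≥ n is open, because every single join entropy is continuous in S
(`continuous_joinEntropy`). If it is also dense, the intersection over all M and n is residual, and
every S in it has infinite entropy.

Density comes from an explicit perturbation of an arbitrary T. Put l = L(j). On j floors over the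
power X^l, let a map climb one floor while applying T to every coordinate, and let it also rotate
the coordinates when it passes from the top floor to the bottom. Seen through coordinate 0 this is
T, except on the top floor, which has measure 1/j. The power ij returns every point to its floor
after exactly i rotations, so coordinate 0 of the inverse power is a power of T applied to
coordinate -i. For i = 1, ..., l these are different coordinates of a product measure, hence
independent, and the normalized join entropy is exactly H(ξ) (`exists_approx`).

The tower is carried to X by an isomorphism mod 0 under which coordinate 0 has the same label as the
original point (`exists_tower_copy`). The label records the cell of ξ and the position relative to
finitely many `A i` and their images and preimages under T. The copy is therefore Halmos-close to T
for large j (`exists_halmosDist_lt`); no Rokhlin lemma is needed. -/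

namespace PEntropy

/-! ### Isomorphism mod 0 of non-atomic standard spaces, respecting a countable labelling. -/

section Isomorphism

open ProbabilityTheory

theorem continuous_cdf (m : Measure ℝ) [IsProbabilityMeasure m] [NullSingletonClass m] :
    Continuous (cdf m) := by
  refine continuous_iff_continuousAt.2 fun a => ?_
  have hmono : Monotone (cdf m) := monotone_cdf m
  rw [hmono.continuousAt_iff_leftLim_eq_rightLim, (cdf m).rightLim_eq]
  have h : (cdf m).measure {a} = 0 := by rw [measure_cdf]; exact measure_singleton a
  rw [StieltjesFunction.measure_singleton, ENNReal.ofReal_eq_zero] at h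
  exact le_antisymm (hmono.leftLim_le le_rfl) (by linarith)

theorem exists_cdf_eq (m : Measure ℝ) [IsProbabilityMeasure m] [NullSingletonClass m] {t : ℝ}
    (h0 : 0 < t) (h1 : t < 1) : ∃ s, cdf m s = t := by
  obtain ⟨a, ha⟩ := ((tendsto_cdf_atBot m).eventually (gt_mem_nhds h0)).exists
  obtain ⟨b, hb⟩ := ((tendsto_cdf_atTop m).eventually (lt_mem_nhds h1)).exists
  exact mem_range_of_exists_le_of_exists_ge (continuous_cdf m) ⟨a, ha.le⟩ ⟨b, hb.le⟩

/-- The distribution function of a non-atomic law pushes it to the uniform law. -/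
theorem map_cdf (m : Measure ℝ) [IsProbabilityMeasure m] [NullSingletonClass m] :
    m.map (cdf m) = volume.restrict (Set.Icc 0 1) := by
  have hmono : Monotone (cdf m) := monotone_cdf m
  have hmeas : Measurable (cdf m) := hmono.measurable
  have : IsProbabilityMeasure (m.map (cdf m)) :=
    Measure.isProbabilityMeasure_map hmeas.aemeasurable
  refine Measure.ext_of_Iic _ _ fun t => ?_
  rw [Measure.map_apply hmeas measurableSet_Iic, Measure.restrict_apply measurableSet_Iic]
  rcases lt_or_ge t 0 with ht | ht
  · have e1 : cdf m ⁻¹' Set.Iic t = ∅ := by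
      ext x
      simpa using ht.trans_le (cdf_nonneg m x)
    have e2 : Set.Iic t ∩ Set.Icc (0 : ℝ) 1 = ∅ := by
      ext x
      simp only [Set.mem_inter_iff, Set.mem_Iic, Set.mem_Icc, Set.mem_empty_iff_false, iff_false]
      intro h
      linarith [h.1, h.2.1]
    rw [e1, e2, measure_empty, measure_empty]
  rcases le_or_gt 1 t with ht1 | ht1
  · have e1 : cdf m ⁻¹' Set.Iic t = Set.univ := by
      ext x
      simpa using (cdf_le_one m x).trans ht1
    have e2 : Set.Iic t ∩ Set.Icc (0 : ℝ) 1 = Set.Icc 0 1 :=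
      Set.inter_eq_right.2 fun x hx => hx.2.trans ht1
    rw [e1, e2, measure_univ, Real.volume_Icc]
    simp
  have e2 : Set.Iic t ∩ Set.Icc (0 : ℝ) 1 = Set.Icc 0 t := by
    ext x
    simp only [Set.mem_inter_iff, Set.mem_Iic, Set.mem_Icc]
    constructor
    · exact fun h => ⟨h.2.1, h.1⟩
    · exact fun h => ⟨h.2, h.1, h.2.trans ht1.le⟩
  rw [e2, Real.volume_Icc, sub_zero]
  suffices h : m.real (cdf m ⁻¹' Set.Iic t) = t by
    rw [← ofReal_measureReal, h]
  -- The cdf may be constant at level t, so a point of level t need not bound the preimage from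
  -- above; a point of level u > t does.
  refine le_antisymm (le_of_forall_gt_imp_ge_of_dense fun u hu => ?_) ?_
  · rcases le_or_gt 1 u with hu1 | hu1
    · exact measureReal_le_one.trans hu1
    obtain ⟨s, hs⟩ := exists_cdf_eq m (ht.trans_lt hu) hu1
    rw [← hs, cdf_eq_real]
    refine measureReal_mono fun y hy => ?_
    by_contra hys
    have h1 := hmono (not_le.1 hys).le
    have h2 : cdf m y ≤ t := hy
    linarith
  · rcases ht.eq_or_lt with h0 | h0
    · rw [← h0]; exact measureReal_nonneg
    obtain ⟨s, hs⟩ := exists_cdf_eq m h0 ht1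
    calc t = m.real (Set.Iic s) := by rw [← hs, cdf_eq_real]
      _ ≤ _ := measureReal_mono fun y hy => (hmono hy).trans hs.le

/-- A non-atomic standard probability space is isomorphic mod 0 to the unit interval, by a map that
carries the fibres of a given countable-valued function to consecutive intervals. -/
theorem exists_uniformization {X : Type*} [MeasurableSpace X] [StandardBorelSpace X]
    (μ : Measure X) [IsProbabilityMeasure μ] [NullSingletonClass μ] {f : X → ℕ}
    (hf : Measurable f) :
    ∃ (F : X → ℝ) (r : ℝ → X), Measurable F ∧ Measurable r ∧
      μ.map F = volume.restrict (Set.Icc 0 1) ∧ (∀ᵐ x ∂μ, r (F x) = x) ∧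
      ∀ᵐ x ∂μ, μ.real (f ⁻¹' Set.Iio (f x)) < F x ∧ F x < μ.real (f ⁻¹' Set.Iio (f x + 1)) := by
  have hne : Nonempty X := μ.nonempty_of_neZero
  -- The integer part of h is f and the fractional part encodes the point, so h is injective and
  -- orders the fibres of f by label.
  set h : X → ℝ := fun x => f x + Real.sigmoid (embeddingReal X x) with hh
  have hf' : Measurable fun x => (f x : ℝ) := measurable_from_top.comp hf
  have hhm : Measurable h :=
    hf'.add (continuous_sigmoid.measurable.comp (measurableEmbedding_embeddingReal X).measurable)
  have hlow : ∀ x, (f x : ℝ) < h x := fun x => by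
    simp only [hh]; linarith [Real.sigmoid_pos (embeddingReal X x)]
  have hupp : ∀ x, h x < f x + 1 := fun x => by
    simp only [hh]; linarith [Real.sigmoid_lt_one (embeddingReal X x)]
  have hinj : Function.Injective h := by
    intro x y hxy
    have hxy' : f x = f y := by
      have h1 : (f x : ℝ) < f y + 1 := (hlow x).trans (hxy ▸ hupp y)
      have h2 : (f y : ℝ) < f x + 1 := (hlow y).trans (hxy ▸ hupp x)
      norm_cast at h1 h2
      omega
    have h3 : Real.sigmoid (embeddingReal X x) = Real.sigmoid (embeddingReal X y) := by
      simp only [hh, hxy'] at hxy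
      linarith
    exact (measurableEmbedding_embeddingReal X).injective (Real.sigmoid_injective h3)
  set m := μ.map h with hm
  have : IsProbabilityMeasure m := Measure.isProbabilityMeasure_map hhm.aemeasurable
  have : NullSingletonClass m := ⟨fun t => by
    rw [hm, Measure.map_apply hhm (measurableSet_singleton t)]
    exact Set.Subsingleton.measure_zero (fun x hx y hy => hinj (hx.trans hy.symm)) _⟩
  have hmono : Monotone (cdf m) := monotone_cdf m
  set F : X → ℝ := fun x => cdf m (h x) with hF
  have hFm : Measurable F := hmono.measurable.comp hhm
  have hFmap : μ.map F = volume.restrict (Set.Icc 0 1) := by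
    rw [← map_cdf m, hm, Measure.map_map hmono.measurable hhm]
    rfl
  -- F can identify points of X only on plateaus of the cdf. Off the null set where F takes the
  -- value of the cdf at some rational, a rational between h x and h y separates F x from F y.
  -- Integers are among these rationals, which gives the strict interval bounds.
  set G : Set X := {x | ∀ q : ℚ, F x ≠ cdf m q} with hG
  have hGm : MeasurableSet G := by
    rw [hG, Set.ofPred_forall]
    exact MeasurableSet.iInter fun q => (hFm (measurableSet_singleton _)).compl
  have hGae : ∀ᵐ x ∂μ, x ∈ G := by
    refine ae_all_iff.2 fun q => ?_
    refine ae_of_ae_map (p := fun t => t ≠ cdf m q) hFm.aemeasurable ?_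
    rw [hFmap]
    exact Measure.ae_ne _ _
  have hlt : ∀ x ∈ G, ∀ q : ℚ, ((q : ℝ) ≤ h x → cdf m q < F x) ∧ (h x ≤ q → F x < cdf m q) :=
    fun x hx q => ⟨fun hq => lt_of_le_of_ne (hmono hq) (hx q).symm,
      fun hq => lt_of_le_of_ne (hmono hq) (hx q)⟩
  have hFinj : ∀ x ∈ G, ∀ y ∈ G, h x < h y → F x < F y := by
    intro x hx y hy hxy
    obtain ⟨q, hq1, hq2⟩ := exists_rat_btwn hxy
    exact ((hlt x hx q).2 hq1.le).trans ((hlt y hy q).1 hq2.le)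
  have hemb : MeasurableEmbedding fun x : G => F x := by
    have : StandardBorelSpace G := hGm.standardBorel
    -- Lusin–Souslin: an injective Borel map is a Borel embedding, hence has a Borel left inverse r.
    refine Measurable.measurableEmbedding (hFm.comp measurable_subtype_coe) ?_
    intro x y hxy
    refine Subtype.ext (hinj ?_)
    by_contra hne
    rcases lt_or_gt_of_ne hne with h1 | h1
    · exact (hFinj _ x.2 _ y.2 h1).ne hxy
    · exact (hFinj _ y.2 _ x.2 h1).ne hxy.symm
  obtain ⟨r, hr, hrF⟩ := hemb.exists_measurable_extend
    (g := fun x : G => (x : X)) measurable_subtype_coe fun _ => hne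
  have hcdf : ∀ n : ℕ, cdf m ((n : ℚ) : ℝ) = μ.real (f ⁻¹' Set.Iio n) := by
    intro n
    rw [cdf_eq_real, hm, map_measureReal_apply hhm measurableSet_Iic]
    congr 1
    ext x
    simp only [Set.mem_preimage, Set.mem_Iic, Set.mem_Iio, Rat.cast_natCast]
    constructor
    · intro h1
      exact_mod_cast (hlow x).trans_le h1
    · intro h1
      have h2 : (f x : ℝ) + 1 ≤ n := by exact_mod_cast h1
      exact (hupp x).le.trans h2
  refine ⟨F, r, hFm, hr, hFmap, ?_, ?_⟩
  · filter_upwards [hGae] with x hx using congrFun hrF ⟨x, hx⟩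
  · filter_upwards [hGae] with x hx
    rw [← hcdf, ← hcdf]
    refine ⟨(hlt x hx _).1 ?_, (hlt x hx _).2 ?_⟩
    · simpa using (hlow x).le
    · simpa using (hupp x).le

/-- Two non-atomic standard probability spaces are isomorphic mod 0, by an isomorphism that
matches two given functions with the same countable law. -/
theorem exists_ae_iso {X Z : Type*} [MeasurableSpace X] [StandardBorelSpace X]
    [MeasurableSpace Z] [StandardBorelSpace Z] (μ : Measure X) [IsProbabilityMeasure μ]
    [NullSingletonClass μ] (ν : Measure Z) [IsProbabilityMeasure ν] [NullSingletonClass ν]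
    {f : X → ℕ} (hf : Measurable f) {g : Z → ℕ} (hg : Measurable g) (hfg : μ.map f = ν.map g) :
    ∃ (π : X → Z) (ψ : Z → X), MeasurePreserving π μ ν ∧ MeasurePreserving ψ ν μ ∧
      (∀ᵐ x ∂μ, ψ (π x) = x) ∧ (∀ᵐ z ∂ν, π (ψ z) = z) ∧ ∀ᵐ x ∂μ, g (π x) = f x := by
  obtain ⟨F, r, hF, hr, hFmap, hrF, hFf⟩ := exists_uniformization μ hf
  obtain ⟨F', r', hF', hr', hFmap', hrF', hFf'⟩ := exists_uniformization ν hg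
  have key : ∀ᵐ x ∂μ, F' (r' (F x)) = F x := by
    refine ae_of_ae_map (p := fun t => F' (r' t) = t) hF.aemeasurable ?_
    rw [hFmap, ← hFmap', ae_map_iff hF'.aemeasurable
      (measurableSet_eq_fun (f := fun t => F' (r' t)) (hF'.comp hr') measurable_id')]
    filter_upwards [hrF'] with z hz
    rw [hz]
  have key' : ∀ᵐ z ∂ν, F (r (F' z)) = F' z := by
    refine ae_of_ae_map (p := fun t => F (r t) = t) hF'.aemeasurable ?_
    rw [hFmap', ← hFmap, ae_map_iff hF.aemeasurable
      (measurableSet_eq_fun (f := fun t => F (r t)) (hF.comp hr) measurable_id')]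
    filter_upwards [hrF] with z hz
    rw [hz]
  have hπ : MeasurePreserving (fun x => r' (F x)) μ ν := by
    refine ⟨hr'.comp hF, ?_⟩
    have h1 : μ.map (fun x => r' (F x)) = (μ.map F).map r' := (Measure.map_map hr' hF).symm
    rw [h1, hFmap, ← hFmap', Measure.map_map hr' hF']
    have h2 : r' ∘ F' =ᵐ[ν] id := hrF'
    rw [Measure.map_congr h2, Measure.map_id]
  have hψ : MeasurePreserving (fun z => r (F' z)) ν μ := by
    refine ⟨hr.comp hF', ?_⟩
    have h1 : ν.map (fun x => r (F' x)) = (ν.map F').map r := (Measure.map_map hr hF').symm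
    rw [h1, hFmap', ← hFmap, Measure.map_map hr hF]
    have h2 : r ∘ F =ᵐ[μ] id := hrF
    rw [Measure.map_congr h2, Measure.map_id]
  refine ⟨fun x => r' (F x), fun z => r (F' z), hπ, hψ, ?_, ?_, ?_⟩
  · filter_upwards [key, hrF] with x h1 h2
    rw [h1, h2]
  · filter_upwards [key', hrF'] with x h1 h2
    rw [h1, h2]
  -- Equal laws give both labellings the same interval endpoints, and F x lies strictly inside the
  -- interval of f x and inside that of g (π x); intervals of different labels are disjoint.
  · have hc : ∀ n, ν.real (g ⁻¹' Set.Iio n) = μ.real (f ⁻¹' Set.Iio n) := fun n => by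
      rw [← map_measureReal_apply hg measurableSet_Iio, ← hfg,
        map_measureReal_apply hf measurableSet_Iio]
    have hmono : ∀ a b : ℕ, a ≤ b → μ.real (f ⁻¹' Set.Iio a) ≤ μ.real (f ⁻¹' Set.Iio b) :=
      fun a b hab => measureReal_mono (Set.preimage_mono (Set.Iio_subset_Iio hab))
    filter_upwards [key, hFf, hπ.quasiMeasurePreserving.ae hFf'] with x h1 h2 h3
    rw [hc, hc, h1] at h3
    rcases lt_trichotomy (g (r' (F x))) (f x) with h | h | h
    · linarith [hmono _ _ (Nat.succ_le_of_lt h), h2.1, h3.2]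
    · exact h
    · linarith [hmono _ _ (Nat.succ_le_of_lt h), h3.1, h2.2]

end Isomorphism

/-! ### Transport of automorphisms along an isomorphism mod 0. -/

section Realization

variable {X Z : Type*} [MeasurableSpace X] [MeasurableSpace Z]

/-- On a standard Borel space the inverse of a measure-preserving bijection is measurable. -/
theorem mem_MPPerm [StandardBorelSpace X] {μ : Measure X} {e : Equiv.Perm X}
    (he : MeasurePreserving (⇑e) μ μ) : e ∈ MPPerm μ := by
  have hemb : MeasurableEmbedding (⇑e) := he.measurable.measurableEmbedding e.injective
  have hinv : Measurable (⇑e⁻¹) := by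
    intro s hs
    have h : ⇑e⁻¹ ⁻¹' s = ⇑e '' s := (Equiv.image_eq_preimage_symm e s).symm
    rw [h]
    exact hemb.measurableSet_image.2 hs
  refine ⟨he, hinv, ?_⟩
  have h := he.map_eq
  calc μ.map (⇑e⁻¹) = (μ.map (⇑e)).map (⇑e⁻¹) := by rw [h]
    _ = μ.map (⇑e⁻¹ ∘ ⇑e) := Measure.map_map hinv he.measurable
    _ = μ := by
      have : ⇑e⁻¹ ∘ ⇑e = id := by ext x; simp
      rw [this, Measure.map_id]

theorem ae_comp_zpow {μ : Measure X} {ν : Measure Z} {π : X → Z}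
    {S : MPPerm μ} {σ : MPPerm ν} (h : ∀ᵐ x ∂μ, π (S.1 x) = σ.1 (π x)) (n : ℤ) :
    ∀ᵐ x ∂μ, π ((S ^ n).1 x) = (σ ^ n).1 (π x) := by
  have hinv : ∀ᵐ x ∂μ, π ((S⁻¹).1 x) = (σ⁻¹).1 (π x) := by
    filter_upwards [S.2.2.quasiMeasurePreserving.ae h] with x hx
    change π (S.1⁻¹ x) = σ.1⁻¹ (π x)
    have h1 : S.1 (S.1⁻¹ x) = x := S.1.apply_symm_apply x
    have hx' : π (S.1 (S.1⁻¹ x)) = σ.1 (π (S.1⁻¹ x)) := hx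
    rw [h1] at hx'
    rw [hx']
    exact (σ.1.symm_apply_apply _).symm
  induction n using Int.induction_on with
  | zero => exact Eventually.of_forall fun x => rfl
  | succ n ih =>
    filter_upwards [S.2.1.quasiMeasurePreserving.ae ih, h] with x h1 h2
    rw [zpow_add_one, zpow_add_one]
    change π ((S ^ (n : ℤ)).1 (S.1 x)) = (σ ^ (n : ℤ)).1 (σ.1 (π x))
    rw [h1, h2]
  | pred n ih =>
    filter_upwards [S.2.2.quasiMeasurePreserving.ae ih, hinv] with x h1 h2
    rw [zpow_sub_one, zpow_sub_one]
    change π ((S ^ (-n : ℤ)).1 ((S⁻¹).1 x)) = (σ ^ (-n : ℤ)).1 ((σ⁻¹).1 (π x))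
    rw [← h2]
    exact h1

/-- An automorphism of a space isomorphic mod 0 to `X` is carried over to an everywhere defined
automorphism of `X`. -/
theorem exists_conj [StandardBorelSpace X] [StandardBorelSpace Z] {μ : Measure X} {ν : Measure Z}
    {π : X → Z} {ψ : Z → X} (hπ : MeasurePreserving π μ ν) (hψ : MeasurePreserving ψ ν μ)
    (hψπ : ∀ᵐ x ∂μ, ψ (π x) = x) (hπψ : ∀ᵐ z ∂ν, π (ψ z) = z) (σ : MPPerm ν) :
    ∃ S : MPPerm μ, ∀ᵐ x ∂μ, π (S.1 x) = σ.1 (π x) := by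
  classical
  -- Asking for the identity along the whole orbit makes E invariant under σ and σ⁻¹. The conjugate
  -- then permutes the conull set D lying over E, and the identity off D completes it to a true
  -- bijection.
  set E : Set Z := {z | ∀ n : ℤ, π (ψ ((σ ^ n).1 z)) = (σ ^ n).1 z} with hE
  have hσ : ∀ n : ℤ, Measurable (⇑(σ ^ n).1) := fun n => (σ ^ n).2.1.measurable
  have hEm : MeasurableSet E := by
    rw [hE, Set.ofPred_forall]
    exact MeasurableSet.iInter fun n =>
      measurableSet_eq_fun ((hπ.measurable.comp hψ.measurable).comp (hσ n)) (hσ n)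
  have hEae : ∀ᵐ z ∂ν, z ∈ E :=
    ae_all_iff.2 fun n => (σ ^ n).2.1.quasiMeasurePreserving.ae hπψ
  have hE0 : ∀ z ∈ E, π (ψ z) = z := fun z hz => by simpa using hz 0
  have hEσ : ∀ z ∈ E, σ.1 z ∈ E := fun z hz n => by
    have := hz (n + 1)
    rw [zpow_add_one] at this
    exact this
  have hEσ' : ∀ z ∈ E, σ.1⁻¹ z ∈ E := fun z hz n => by
    have := hz (n - 1)
    rw [zpow_sub_one] at this
    exact this
  set D : Set X := {x | ψ (π x) = x ∧ π x ∈ E} with hD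
  have hDm : MeasurableSet D :=
    (measurableSet_eq_fun (hψ.measurable.comp hπ.measurable) measurable_id).inter
      (hπ.measurable hEm)
  have hDae : ∀ᵐ x ∂μ, x ∈ D := by
    filter_upwards [hψπ, hπ.quasiMeasurePreserving.ae hEae] with x h1 h2 using ⟨h1, h2⟩
  have hψD : ∀ z ∈ E, ψ z ∈ D := fun z hz => ⟨by rw [hE0 z hz], by rw [hE0 z hz]; exact hz⟩
  let S : Equiv.Perm X :=
    { toFun := fun x => if x ∈ D then ψ (σ.1 (π x)) else x
      invFun := fun x => if x ∈ D then ψ (σ.1⁻¹ (π x)) else x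
      left_inv := fun x => by
        by_cases hx : x ∈ D
        · have h1 := hEσ _ hx.2
          simp only [hx, if_true, hψD _ h1, hE0 _ h1]
          exact (congrArg ψ (σ.1.symm_apply_apply _)).trans hx.1
        · simp only [hx, if_false]
      right_inv := fun x => by
        by_cases hx : x ∈ D
        · have h1 := hEσ' _ hx.2
          simp only [hx, if_true, hψD _ h1, hE0 _ h1]
          exact (congrArg ψ (σ.1.apply_symm_apply _)).trans hx.1
        · simp only [hx, if_false] }
  have hSap : ∀ x ∈ D, S x = ψ (σ.1 (π x)) := fun x hx => if_pos hx
  have hcomp : MeasurePreserving (fun x => ψ (σ.1 (π x))) μ μ := hψ.comp (σ.2.1.comp hπ)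
  have hSmp : MeasurePreserving (⇑S) μ μ := by
    refine ⟨Measurable.ite hDm hcomp.measurable measurable_id, ?_⟩
    have h : ⇑S =ᵐ[μ] fun x => ψ (σ.1 (π x)) := by
      filter_upwards [hDae] with x hx using hSap x hx
    rw [Measure.map_congr h, hcomp.map_eq]
  refine ⟨⟨S, mem_MPPerm hSmp⟩, ?_⟩
  filter_upwards [hDae] with x hx
  rw [hSap x hx, hE0 _ (hEσ _ hx.2)]

end Realization

/-! ### The tower automorphism and its powers. -/

section Tower

open ProbabilityTheory

variable {X : Type*} [MeasurableSpace X]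

theorem measurePreserving_uniformOn_univ {ι : Type*} [Fintype ι] [MeasurableSpace ι]
    [MeasurableSingletonClass ι] (e : ι ≃ ι) :
    MeasurePreserving e (uniformOn Set.univ) (uniformOn Set.univ) := by
  refine ⟨measurable_of_countable _, Measure.ext fun s hs => ?_⟩
  rw [Measure.map_apply (measurable_of_countable _) hs, uniformOn_univ, uniformOn_univ,
    ← Measure.count_injective_image e.injective, Set.image_preimage_eq _ e.surjective]

theorem measurePreserving_apply_add {μ : Measure X} [IsProbabilityMeasure μ] (T : MPPerm μ) {l : ℕ}
    [NeZero l] (c : ZMod l) :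
    MeasurePreserving (fun (y : ZMod l → X) a => T.1 (y (a + c)))
      (Measure.pi fun _ => μ) (Measure.pi fun _ => μ) := by
  have h1 := measurePreserving_arrowCongr' (fun _ : ZMod l => μ) (fun _ : ZMod l => μ)
    (Equiv.addRight c).symm (MeasurableEquiv.refl X) fun _ => MeasurePreserving.id μ
  have h2 := measurePreserving_pi (fun _ : ZMod l => μ) (fun _ : ZMod l => μ) fun _ => T.2.1
  exact h2.comp h1

/-- The measure of the tower of height `j` over the power `X ^ l`. -/
noncomputable def towerMeasure (μ : Measure X) (j l : ℕ) [NeZero j] [NeZero l] :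
    Measure (Fin j × (ZMod l → X)) :=
  (uniformOn Set.univ).prod (Measure.pi fun _ => μ)

instance isProbabilityMeasure_towerMeasure (μ : Measure X) [IsProbabilityMeasure μ] (j l : ℕ)
    [NeZero j] [NeZero l] : IsProbabilityMeasure (towerMeasure μ j l) := by
  unfold towerMeasure
  infer_instance

instance nullSingletonClass_towerMeasure (μ : Measure X) [IsProbabilityMeasure μ]
    [NullSingletonClass μ] (j l : ℕ) [NeZero j] [NeZero l] :
    NullSingletonClass (towerMeasure μ j l) := by
  unfold towerMeasure
  infer_instance

theorem measurePreserving_tower_eval (μ : Measure X) [IsProbabilityMeasure μ] (j l : ℕ) [NeZero j]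
    [NeZero l] :
    MeasurePreserving (fun z : Fin j × (ZMod l → X) => z.2 0) (towerMeasure μ j l) μ :=
  (measurePreserving_eval (fun _ : ZMod l => μ) 0).comp measurePreserving_snd

/-- The number of coordinates by which `towerPerm` rotates on the level `t`. -/
def towerShift {j : ℕ} (l : ℕ) (t : Fin j) : ZMod l := if j ∣ t.val + 1 then 1 else 0

/-- The map that climbs the tower applying `T` to all coordinates, and that rotates the coordinates
when it goes from the top to the bottom. -/
def towerPerm (T : Equiv.Perm X) (j l : ℕ) [NeZero j] : Equiv.Perm (Fin j × (ZMod l → X)) :=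
  Equiv.prodShear (Equiv.addRight 1) fun t =>
    Equiv.arrowCongr (Equiv.addRight (towerShift l t)).symm T

variable [StandardBorelSpace X] {μ : Measure X} [IsProbabilityMeasure μ]

/-- `towerPerm` as an automorphism of the tower. -/
noncomputable def tower (T : MPPerm μ) (j l : ℕ) [NeZero j] [NeZero l] : MPPerm (towerMeasure μ j l) :=
  ⟨towerPerm T.1 j l, mem_MPPerm (by
    refine MeasurePreserving.skew_product (f := fun t : Fin j => t + 1)
      (g := fun t (y : ZMod l → X) a => T.1 (y (a + towerShift l t)))
      (measurePreserving_uniformOn_univ (Equiv.addRight 1)) ?_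
      (Eventually.of_forall fun t => (measurePreserving_apply_add T _).map_eq)
    exact measurable_from_prod_countable_right fun t =>
      (measurePreserving_apply_add T (towerShift l t)).measurable)⟩

/-- Starting from floor t, n steps cross from top to bottom (t + n) / j times, and each crossing
contributes one rotation. -/
theorem tower_pow_apply (T : MPPerm μ) (j l : ℕ) [NeZero j] [NeZero l] (n : ℕ) (t : Fin j)
    (y : ZMod l → X) :
    ((tower T j l ^ n).1 (t, y)).1.val = (t.val + n) % j ∧
      ((tower T j l ^ n).1 (t, y)).2 =
        fun a => (T ^ n).1 (y (a + (((t.val + n) / j : ℕ) : ZMod l))) := by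
  induction n with
  | zero =>
    refine ⟨(Nat.mod_eq_of_lt t.2).symm, ?_⟩
    funext a
    simp [Nat.div_eq_of_lt t.2]
  | succ n ih =>
    obtain ⟨ih1, ih2⟩ := ih
    set p := (tower T j l ^ n).1 (t, y) with hp
    have hstep : (tower T j l ^ (n + 1)).1 (t, y) =
        (p.1 + 1, fun a => T.1 (p.2 (a + towerShift l p.1))) := by
      rw [pow_succ']
      rfl
    rw [hstep]
    constructor
    · simp only [Fin.val_add, ih1, Fin.val_one', ← add_assoc]
      rw [← Nat.add_mod]
    · funext a
      rw [ih2, pow_succ']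
      change T.1 ((T ^ n).1 _) = T.1 ((T ^ n).1 _)
      congr 3
      rw [add_assoc]
      congr 1
      have hd : j ∣ p.1.val + 1 ↔ j ∣ t.val + n + 1 := by
        rw [ih1, Nat.dvd_iff_mod_eq_zero, Nat.dvd_iff_mod_eq_zero, Nat.mod_add_mod]
      rw [← add_assoc, Nat.succ_div]
      unfold towerShift
      by_cases h : j ∣ t.val + n + 1
      · rw [if_pos h, if_pos (hd.2 h)]
        push_cast
        ring
      · simp [h, mt hd.1 h]

/-- A run of ij steps makes exactly i crossings from any floor, so the rotation does not depend on
t. This is what makes multiples of j, and hence progressions, special. -/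
theorem tower_zpow_inv_apply (T : MPPerm μ) (j l : ℕ) [NeZero j] [NeZero l] (i : ℕ) (t : Fin j)
    (y : ZMod l → X) :
    (((tower T j l ^ ((i : ℤ) * (j : ℤ)))⁻¹).1 (t, y)).2 0 =
      ((T ^ ((i : ℤ) * (j : ℤ)))⁻¹).1 (y (-(i : ZMod l))) := by
  rw [← Nat.cast_mul, zpow_natCast, zpow_natCast]
  set w : ZMod l → X := fun a => ((T ^ (i * j))⁻¹).1 (y (a - i)) with hw
  have h : (tower T j l ^ (i * j)).1 (t, w) = (t, y) := by
    obtain ⟨h1, h2⟩ := tower_pow_apply T j l (i * j) t w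
    refine Prod.ext (Fin.ext ?_) ?_
    · rw [h1, Nat.add_mul_mod_self_right, Nat.mod_eq_of_lt t.2]
    · rw [h2]
      funext a
      rw [Nat.add_mul_div_right _ _ (NeZero.pos j), Nat.div_eq_of_lt t.2, zero_add, hw]
      simp only [add_sub_cancel_right]
      exact (T ^ (i * j)).1.apply_symm_apply _
  have h' : ((tower T j l ^ (i * j))⁻¹).1 (t, y) = (t, w) := by
    rw [← h]
    exact (tower T j l ^ (i * j)).1.symm_apply_apply _
  rw [h', hw]
  simp

/-- One step of the tower acts as `T` off a set of measure `1 / j`. -/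
theorem tower_measureReal_le (T : MPPerm μ) (j l : ℕ) [NeZero j] [NeZero l] {R : X → X → Prop}
    (hR : ∀ x, ¬ R x (T.1 x)) :
    (towerMeasure μ j l).real {z | R (z.2 0) (((tower T j l).1 z).2 0)} ≤ 1 / j := by
  have hj : 0 < j := NeZero.pos j
  let top : Fin j := ⟨j - 1, by omega⟩
  have hsub : {z : Fin j × (ZMod l → X) | R (z.2 0) (((tower T j l).1 z).2 0)} ⊆
      {top} ×ˢ Set.univ := by
    rintro ⟨t, y⟩ hz
    refine ⟨?_, trivial⟩
    by_contra ht
    have hnd : ¬ j ∣ t.val + 1 := by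
      intro hd
      have h1 := Nat.le_of_dvd (Nat.succ_pos _) hd
      exact ht (Fin.ext (show t.val = j - 1 by have := t.2; omega))
    have hz' : R (y 0) (T.1 (y (0 + towerShift l t))) := hz
    rw [towerShift, if_neg hnd, add_zero] at hz'
    exact hR _ hz'
  refine (measureReal_mono hsub).trans (le_of_eq ?_)
  rw [towerMeasure, measureReal_prod_prod, probReal_univ, mul_one, measureReal_def, uniformOn_univ,
    Measure.count_singleton]
  simp

end Tower

/-! ### Entropy of a product distribution. -/

section ProductEntropy

/-- Each summand is kept as a product over q, so that a later sum over all words factors coordinate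
by coordinate. If some factor vanishes, both sides are zero. -/
theorem negMulLog_prod {ι : Type*} [Fintype ι] [DecidableEq ι] (b : ι → ℝ) :
    Real.negMulLog (∏ q, b q) = ∑ p, ∏ q, (b q * if q = p then -Real.log (b q) else 1) := by
  have h : ∀ p, ∏ q, (b q * if q = p then -Real.log (b q) else 1) =
      (∏ q, b q) * -Real.log (b p) := fun p => by
    rw [Finset.prod_mul_distrib, Finset.prod_ite_eq' Finset.univ p fun q => -Real.log (b q)]
    simp
  simp only [h, ← Finset.mul_sum, Finset.sum_neg_distrib]
  by_cases h0 : ∃ q, b q = 0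
  · obtain ⟨q, hq⟩ := h0
    simp [Finset.prod_eq_zero (Finset.mem_univ q) hq]
  · push Not at h0
    rw [Real.negMulLog, Real.log_prod fun q _ => h0 q]
    ring

/-- The entropy of a power of a probability vector. -/
theorem sum_negMulLog_prod {ι κ : Type*} [Fintype ι] [DecidableEq ι] [Fintype κ] {a : κ → ℝ}
    (ha : ∑ v, a v = 1) :
    ∑ c : ι → κ, Real.negMulLog (∏ p, a (c p)) =
      Fintype.card ι * ∑ v, Real.negMulLog (a v) := by
  simp only [negMulLog_prod]
  rw [Finset.sum_comm]
  have h : ∀ p : ι, ∑ c : ι → κ,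
      ∏ q, (a (c q) * if q = p then -Real.log (a (c q)) else 1) = ∑ v, Real.negMulLog (a v) := by
    intro p
    rw [← Fintype.prod_sum fun q v => a v * if q = p then -Real.log (a v) else 1,
      Fintype.prod_eq_single p]
    · simp [Real.negMulLog]
    · intro q hq
      simp [hq, ha]
  rw [Finset.sum_congr rfl fun p _ => h p, Finset.sum_const, Finset.card_univ, nsmul_eq_mul]

end ProductEntropy

/-! ### Copies of the tower on X and independence along the progression. -/

section TowerCopy

variable {X : Type*} [MeasurableSpace X]

theorem card_progression (L : ℕ → ℕ) (j : ℕ) [NeZero j] : (progression L j).card = L j := by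
  rw [progression, Finset.card_image_of_injective, Nat.card_Icc, Nat.add_sub_cancel]
  intro a b hab
  have hj : (j : ℤ) ≠ 0 := by exact_mod_cast NeZero.ne j
  exact_mod_cast mul_right_cancel₀ hj hab

/-- The power indexed by i·j reads coordinate -i, and as i runs over 1, ..., L(j) every residue mod
L(j) is read exactly once. -/
theorem exists_progression_equiv (L : ℕ → ℕ) (j : ℕ) [NeZero j] [NeZero (L j)] :
    ∃ (e : progression L j ≃ ZMod (L j)) (i : progression L j → ℕ),
      ∀ p : progression L j, (p : ℤ) = (i p : ℤ) * (j : ℤ) ∧ e p = -(i p : ZMod (L j)) := by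
  have h : ∀ p : progression L j, ∃ i : ℕ, i ∈ Finset.Icc 1 (L j) ∧ (i : ℤ) * (j : ℤ) = p :=
    fun p => Finset.mem_image.1 p.2
  choose i hi hip using h
  have hinj : Function.Injective fun p => -(i p : ZMod (L j)) := by
    intro p q hpq
    have h1 : (i p : ZMod (L j)) = i q := neg_injective hpq
    rw [ZMod.natCast_eq_natCast_iff] at h1
    have hp := Finset.mem_Icc.1 (hi p)
    have hq := Finset.mem_Icc.1 (hi q)
    have h2 : i p = i q := by
      have h3 : (i p - 1) ≡ (i q - 1) [MOD L j] := by
        refine Nat.ModEq.add_right_cancel' 1 ?_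
        rwa [Nat.sub_add_cancel hp.1, Nat.sub_add_cancel hq.1]
      have h4 := h3.eq_of_lt_of_lt (by omega) (by omega)
      omega
    exact Subtype.ext (by rw [← hip p, ← hip q, h2])
  have hbij : Function.Bijective fun p => -(i p : ZMod (L j)) := by
    refine (Fintype.bijective_iff_injective_and_card _).2 ⟨hinj, ?_⟩
    rw [Fintype.card_coe, card_progression, ZMod.card]
  exact ⟨Equiv.ofBijective _ hbij, i, fun p => ⟨(hip p).symm, rfl⟩⟩

variable [StandardBorelSpace X] {μ : Measure X} [IsProbabilityMeasure μ] [NullSingletonClass μ]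
  {ι : Type*} [Countable ι] [MeasurableSpace ι] [MeasurableSingletonClass ι]

/-- A copy on `X` of the tower automorphism, for which a given countable-valued function is
carried to the zeroth coordinate. -/
theorem exists_tower_copy (T : MPPerm μ) (j l : ℕ) [NeZero j] [NeZero l] {f : X → ι}
    (hf : Measurable f) :
    ∃ (S : MPPerm μ) (π : X → Fin j × (ZMod l → X)),
      MeasurePreserving π μ (towerMeasure μ j l) ∧
      (∀ᵐ x ∂μ, π (S.1 x) = (tower T j l).1 (π x)) ∧ ∀ᵐ x ∂μ, f ((π x).2 0) = f x := by
  obtain ⟨e, he⟩ := exists_injective_nat ι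
  have hef : Measurable fun x => e (f x) := (measurable_of_countable e).comp hf
  have hev := measurePreserving_tower_eval μ j l
  obtain ⟨π, ψ, hπ, hψ, hψπ, hπψ, hfπ⟩ := exists_ae_iso μ (towerMeasure μ j l) hef
    (hef.comp hev.measurable) (by rw [← Measure.map_map hef hev.measurable, hev.map_eq])
  obtain ⟨S, hS⟩ := exists_conj hπ hψ hψπ hπψ (tower T j l)
  refine ⟨S, π, hπ, hS, ?_⟩
  filter_upwards [hfπ] with x hx using he hx

/-- Every automorphism `T` is approximated, on finitely many sets, by an automorphism `S` for which
the partitions `Sᵖ ξ`, `p` in the progression, are independent. -/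
theorem exists_approx (T : MPPerm μ) (L : ℕ → ℕ) (j : ℕ) [NeZero j] [NeZero (L j)] {f : X → ι}
    (hf : Measurable f) {k : ℕ} (u : ι → Fin k) :
    ∃ S : MPPerm μ,
      (∀ R : ι → ι → Prop, (∀ x, ¬ R (f x) (f (T.1 x))) →
        μ.real {x | R (f x) (f (S.1 x))} ≤ 1 / j) ∧
      partEntropy μ (joinPartition S (progression L j) fun x => u (f x)) =
        L j * partEntropy μ fun x => u (f x) := by
  classical
  obtain ⟨S, π, hπ, hS, hfπ⟩ := exists_tower_copy T j (L j) hf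
  refine ⟨S, fun R hR => ?_, ?_⟩
  · refine le_trans ?_ (tower_measureReal_le T j (L j) (R := fun x y => R (f x) (f y)) hR)
    have h1 : {x | R (f x) (f (S.1 x))} =ᵐ[μ]
        π ⁻¹' {z | R (f (z.2 0)) (f (((tower T j (L j)).1 z).2 0))} := by
      filter_upwards [hfπ, S.2.1.quasiMeasurePreserving.ae hfπ, hS] with x h1 h2 h3
      refine propext ?_
      change R (f x) (f (S.1 x)) ↔ R (f ((π x).2 0)) (f (((tower T j (L j)).1 (π x)).2 0))
      rw [← h3, h1, h2]
    rw [measureReal_congr h1, measureReal_def, measureReal_def]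
    exact ENNReal.toReal_mono (measure_ne_top _ _) (hπ.measure_preimage_le _)
  set ξ : X → Fin k := fun x => u (f x) with hξ
  have hξm : Measurable ξ := (measurable_of_countable u).comp hf
  have hcell : ∀ c : progression L j → Fin k,
      μ.real (joinPartition S (progression L j) ξ ⁻¹' {c}) = ∏ p, μ.real (ξ ⁻¹' {c p}) := by
    intro c
    obtain ⟨e, i, hei⟩ := exists_progression_equiv L j
    have hmp : ∀ p : ℤ, MeasurePreserving (⇑((T ^ p)⁻¹).1) μ μ := fun p => ((T ^ p)⁻¹).2.1
    set B : ZMod (L j) → Set X := fun a =>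
      ⇑((T ^ ((e.symm a : progression L j) : ℤ))⁻¹).1 ⁻¹' (ξ ⁻¹' {c (e.symm a)}) with hB
    -- A cell of the join is, up to a null set, the pullback of a box in the product, so its measure
    -- factors.
    have hae : joinPartition S (progression L j) ξ ⁻¹' {c} =ᵐ[μ]
        π ⁻¹' (Set.univ ×ˢ Set.univ.pi B) := by
      have h1 : ∀ p : progression L j, ∀ᵐ x ∂μ,
          ξ (((S ^ (p : ℤ))⁻¹).1 x) = ξ (((T ^ (p : ℤ))⁻¹).1 ((π x).2 (e p))) := by
        intro p
        have h2 := ae_comp_zpow hS (-(p : ℤ))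
        filter_upwards [h2, ((S ^ (p : ℤ))⁻¹).2.1.quasiMeasurePreserving.ae hfπ] with x h2 h3
        rw [zpow_neg, zpow_neg] at h2
        have h4 := tower_zpow_inv_apply T j (L j) (i p) (π x).1 (π x).2
        rw [← (hei p).1, ← (hei p).2] at h4
        simp only [hξ]
        rw [← h3, h2]
        exact congrArg (fun x => u (f x)) h4
      filter_upwards [ae_all_iff.2 h1] with x hx
      refine propext ?_
      change joinPartition S (progression L j) ξ x = c ↔ π x ∈ Set.univ ×ˢ Set.univ.pi B
      simp only [Set.mem_prod, Set.mem_univ, true_and, Set.mem_univ_pi]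
      constructor
      · intro h a
        have h5 := hx (e.symm a)
        rw [e.apply_symm_apply] at h5
        exact h5.symm.trans (congrFun h (e.symm a))
      · intro h
        funext p
        have h5 := h (e p)
        simp only [hB, e.symm_apply_apply] at h5
        exact (hx p).trans h5
    have hBm : ∀ a, MeasurableSet (B a) := fun a =>
      (hmp _).measurable (hξm (measurableSet_singleton _))
    rw [measureReal_congr hae, hπ.measureReal_preimage
      (MeasurableSet.univ.prod (MeasurableSet.univ_pi hBm)).nullMeasurableSet, towerMeasure,
      measureReal_prod_prod, probReal_univ, one_mul, measureReal_def, Measure.pi_pi,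
      ENNReal.toReal_prod, ← e.prod_comp]
    refine Finset.prod_congr rfl fun p _ => ?_
    rw [← measureReal_def, hB]
    simp only [e.symm_apply_apply]
    exact (hmp _).measureReal_preimage (hξm (measurableSet_singleton _)).nullMeasurableSet
  have hsum : ∑ v, μ.real (ξ ⁻¹' {v}) = 1 := by
    have h := sum_measureReal_preimage_singleton (μ := μ) (f := ξ) Finset.univ
      fun v _ => hξm (measurableSet_singleton v)
    rw [h]
    simp
  unfold partEntropy
  simp only [hcell]
  rw [sum_negMulLog_prod hsum, Fintype.card_coe, card_progression]

end TowerCopy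

/-! ### Continuity of the join entropy in the Halmos metric. -/

section Continuity

variable {X : Type*} [MeasurableSpace X] {μ : Measure X}

theorem measureReal_preimage_symmDiff (S : MPPerm μ) {B C : Set X} (hB : MeasurableSet B)
    (hC : MeasurableSet C) : μ.real ((⇑S.1 ⁻¹' B) ∆ (⇑S.1 ⁻¹' C)) = μ.real (B ∆ C) := by
  rw [← Set.preimage_symmDiff]
  exact S.2.1.measureReal_preimage (hB.symmDiff hC).nullMeasurableSet

variable [IsProbabilityMeasure μ] {β : Type*} {l : Filter β}

theorem halmosTerm_le_halmosDist (A : ℕ → Set X) (S T : MPPerm μ) (i : ℕ) :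
    halmosTerm μ (A i) S T ≤ 2 ^ (i + 1) * halmosDist μ A S T := by
  have h := (halmos_summable A S T).le_tsum i fun k _ =>
    mul_nonneg (by positivity) (halmosTerm_nonneg _ _ _)
  have h2 : (2 : ℝ) ^ (i + 1) * ((1 / 2 : ℝ) ^ (i + 1) * halmosTerm μ (A i) S T) =
      halmosTerm μ (A i) S T := by
    rw [← mul_assoc, ← mul_pow]
    norm_num
  rw [← h2]
  exact mul_le_mul_of_nonneg_left h (by positivity)

theorem tendsto_halmosDist {A : ℕ → Set X} {S : MPPerm μ} {T : β → MPPerm μ}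
    (h : ∀ i, Tendsto (fun b => halmosTerm μ (A i) S (T b)) l (𝓝 0)) :
    Tendsto (fun b => halmosDist μ A S (T b)) l (𝓝 0) := by
  have h0 : (0 : ℝ) = ∑' i : ℕ, (1 / 2 : ℝ) ^ (i + 1) * 0 := by simp
  rw [h0]
  refine tendsto_tsum_of_dominated_convergence (bound := fun i : ℕ => (1 / 2 : ℝ) ^ i)
    summable_geometric_two (fun i => (h i).const_mul _) (Eventually.of_forall fun b i => ?_)
  rw [Real.norm_of_nonneg (mul_nonneg (by positivity) (halmosTerm_nonneg _ _ _))]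
  calc (1 / 2 : ℝ) ^ (i + 1) * halmosTerm μ (A i) S (T b)
      ≤ (1 / 2 : ℝ) ^ (i + 1) * 2 :=
        mul_le_mul_of_nonneg_left (halmosTerm_le _ _ _) (by positivity)
    _ = (1 / 2 : ℝ) ^ i := by ring

/-- Convergence in the weak topology, without the requirement on the inverses. -/
def TendstoWeak (l : Filter β) (T : β → MPPerm μ) (S : MPPerm μ) : Prop :=
  ∀ B, MeasurableSet B → Tendsto (fun b => μ.real ((⇑S.1 ⁻¹' B) ∆ (⇑(T b).1 ⁻¹' B))) l (𝓝 0)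

/-- Measure preservation makes the error of replacing B by a nearby `A i` the same for S and for
every T b. -/
theorem TendstoWeak.of_dense {A : ℕ → Set X} (hA : IsDenseFamily μ A) {T : β → MPPerm μ}
    {S : MPPerm μ}
    (h : ∀ i, Tendsto (fun b => μ.real ((⇑S.1 ⁻¹' A i) ∆ (⇑(T b).1 ⁻¹' A i))) l (𝓝 0)) :
    TendstoWeak l T S := by
  intro B hB
  refine tendsto_order.2 ⟨fun a ha => Eventually.of_forall fun b => ha.trans_le measureReal_nonneg,
    fun ε hε => ?_⟩
  obtain ⟨i, hi⟩ := hA.2 B hB (ε / 4) (by positivity)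
  filter_upwards [(h i).eventually (gt_mem_nhds (show (0 : ℝ) < ε / 4 by positivity))] with b hb
  have t1 := measureReal_symmDiff_le (μ := μ) (s := ⇑S.1 ⁻¹' B) (t := ⇑S.1 ⁻¹' A i)
    (⇑(T b).1 ⁻¹' B)
  have t2 := measureReal_symmDiff_le (μ := μ) (s := ⇑S.1 ⁻¹' A i) (t := ⇑(T b).1 ⁻¹' A i)
    (⇑(T b).1 ⁻¹' B)
  rw [measureReal_preimage_symmDiff S hB (hA.1 i), symmDiff_comm B] at t1
  rw [measureReal_preimage_symmDiff (T b) (hA.1 i) hB] at t2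
  linarith

/-- Change one factor at a time: first the inner one, on the fixed set S⁻¹B, then the outer one,
whose error T' b preserves. -/
theorem TendstoWeak.mul {T T' : β → MPPerm μ} {S S' : MPPerm μ} (h : TendstoWeak l T S)
    (h' : TendstoWeak l T' S') : TendstoWeak l (fun b => T b * T' b) (S * S') := by
  intro B hB
  refine squeeze_zero (fun _ => measureReal_nonneg) (fun b => ?_)
    (by simpa using (h' _ (S.2.1.measurable hB)).add (h B hB))
  have t1 := measureReal_symmDiff_le (μ := μ) (s := ⇑S'.1 ⁻¹' (⇑S.1 ⁻¹' B))
    (t := ⇑(T' b).1 ⁻¹' (⇑S.1 ⁻¹' B)) (⇑(T' b).1 ⁻¹' (⇑(T b).1 ⁻¹' B))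
  rw [measureReal_preimage_symmDiff (T' b) (S.2.1.measurable hB) ((T b).2.1.measurable hB)] at t1
  exact t1

theorem TendstoWeak.zpow {T : β → MPPerm μ} {S : MPPerm μ} (h : TendstoWeak l T S)
    (h' : TendstoWeak l (fun b => (T b)⁻¹) S⁻¹) (n : ℤ) :
    TendstoWeak l (fun b => T b ^ n) (S ^ n) := by
  induction n using Int.induction_on with
  | zero =>
    intro B _
    simpa using tendsto_const_nhds
  | succ n ih => simpa only [zpow_add_one] using ih.mul h
  | pred n ih => simpa only [zpow_sub_one] using ih.mul h'

theorem tendstoWeak_of_halmosDist {A : ℕ → Set X} (hA : IsDenseFamily μ A) {T : β → MPPerm μ}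
    {S : MPPerm μ} (h : Tendsto (fun b => halmosDist μ A S (T b)) l (𝓝 0)) :
    TendstoWeak l T S ∧ TendstoWeak l (fun b => (T b)⁻¹) S⁻¹ := by
  have ht : ∀ i, Tendsto (fun b => halmosTerm μ (A i) S (T b)) l (𝓝 0) := fun i =>
    squeeze_zero (fun _ => halmosTerm_nonneg _ _ _) (fun b => halmosTerm_le_halmosDist A S (T b) i)
      (by simpa using h.const_mul ((2 : ℝ) ^ (i + 1)))
  constructor
  · refine TendstoWeak.of_dense hA fun i =>
      squeeze_zero (fun _ => measureReal_nonneg) (fun b => ?_) (ht i)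
    rw [halmosTerm, image_inv_eq_preimage, image_inv_eq_preimage]
    exact le_add_of_nonneg_left measureReal_nonneg
  · refine TendstoWeak.of_dense hA fun i =>
      squeeze_zero (fun _ => measureReal_nonneg) (fun b => ?_) (ht i)
    rw [halmosTerm, image_eq_preimage_inv, image_eq_preimage_inv]
    exact le_add_of_nonneg_right measureReal_nonneg

theorem tendsto_partEntropy_joinPartition {A : ℕ → Set X} (hA : IsDenseFamily μ A)
    {T : β → MPPerm μ} {S : MPPerm μ}
    (h : Tendsto (fun b => halmosDist μ A S (T b)) l (𝓝 0)) (F : Finset ℤ) {k : ℕ}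
    {ξ : X → Fin k} (hξ : Measurable ξ) :
    Tendsto (fun b => partEntropy μ (joinPartition (T b) F ξ)) l
      (𝓝 (partEntropy μ (joinPartition S F ξ))) := by
  obtain ⟨h1, h2⟩ := tendstoWeak_of_halmosDist hA h
  refine tendsto_finsetSum _ fun c _ => (Real.continuous_negMulLog.tendsto _).comp ?_
  have hpre : ∀ R : MPPerm μ, joinPartition R F ξ ⁻¹' {c} =
      ⋂ p : F, ⇑(R ^ (-(p : ℤ))).1 ⁻¹' (ξ ⁻¹' {c p}) := by
    intro R
    ext x
    simp only [zpow_neg, Set.mem_iInter]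
    exact funext_iff
  have hm : ∀ R : MPPerm μ, MeasurableSet (joinPartition R F ξ ⁻¹' {c}) := by
    intro R
    rw [hpre]
    exact MeasurableSet.iInter fun p =>
      (R ^ (-(p : ℤ))).2.1.measurable (hξ (measurableSet_singleton _))
  have hlim : Tendsto (fun b => ∑ p : F, μ.real ((⇑(S ^ (-(p : ℤ))).1 ⁻¹' (ξ ⁻¹' {c p})) ∆
      (⇑(T b ^ (-(p : ℤ))).1 ⁻¹' (ξ ⁻¹' {c p})))) l (𝓝 0) := by
    have := tendsto_finsetSum (Finset.univ : Finset F) fun p _ =>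
      (h1.zpow h2 (-(p : ℤ))) (ξ ⁻¹' {c p}) (hξ (measurableSet_singleton _))
    simpa using this
  rw [tendsto_iff_dist_tendsto_zero]
  refine squeeze_zero (fun _ => dist_nonneg) (fun b => ?_) hlim
  rw [Real.dist_eq, abs_sub_comm]
  -- A cell is a finite intersection, and the symmetric difference of two intersections lies in the
  -- union of the symmetric differences.
  refine (abs_measureReal_sub_le_measureReal_symmDiff (hm S).nullMeasurableSet
    (hm (T b)).nullMeasurableSet).trans ?_
  refine (measureReal_mono ?_).trans (measureReal_iUnion_fintype_le _)
  rw [hpre, hpre]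
  rintro x (⟨hx1, hx2⟩ | ⟨hx1, hx2⟩)
  · rw [Set.mem_iInter, not_forall] at hx2
    obtain ⟨p, hp⟩ := hx2
    exact Set.mem_iUnion.2 ⟨p, Or.inl ⟨Set.mem_iInter.1 hx1 p, hp⟩⟩
  · rw [Set.mem_iInter, not_forall] at hx2
    obtain ⟨p, hp⟩ := hx2
    exact Set.mem_iUnion.2 ⟨p, Or.inr ⟨Set.mem_iInter.1 hx1 p, hp⟩⟩

theorem continuous_joinEntropy [StandardBorelSpace X] {A : ℕ → Set X} (hA : IsDenseFamily μ A)
    (F : Finset ℤ) {k : ℕ} {ξ : X → Fin k} (hξ : Measurable ξ) :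
    letI := halmosMetric μ hA
    Continuous fun S : Aut μ => joinEntropy S F ξ := by
  let _ := halmosMetric μ hA
  refine continuous_iff_continuousAt.2 fun S => ?_
  induction S using Con.induction_on with | _ S
  have hsurj : Function.Surjective fun T : MPPerm μ => (T : Aut μ) := Quotient.mk_surjective
  -- The projection is onto, so the limit may be computed on representatives.
  rw [ContinuousAt, ← map_comap_of_surjective hsurj (𝓝 (S : Aut μ)), tendsto_map'_iff]
  refine tendsto_partEntropy_joinPartition hA (S := S) (T := fun T => T) ?_ F hξ
  have h1 : Tendsto (fun T : Aut μ => dist (S : Aut μ) T) (𝓝 (S : Aut μ)) (𝓝 0) := by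
    have h2 : Continuous fun T : Aut μ => dist (S : Aut μ) T := continuous_const.dist continuous_id
    simpa only [dist_self] using h2.tendsto (S : Aut μ)
  exact h1.comp tendsto_comap

end Continuity

/-! ### Approximation in the Halmos metric. -/

section Density

variable {X : Type*} [MeasurableSpace X] [StandardBorelSpace X] {μ : Measure X}
  [IsProbabilityMeasure μ] [NullSingletonClass μ]

/-- The floors of a tower of height k over the identity have equal measure; only the isomorphism
with X is used. -/
theorem exists_partEntropy_eq_log (μ : Measure X) [IsProbabilityMeasure μ] [NullSingletonClass μ]
    (k : ℕ) [NeZero k] :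
    ∃ ξ : X → Fin k, Measurable ξ ∧ partEntropy μ ξ = Real.log k := by
  obtain ⟨-, π, hπ, -, -⟩ := exists_tower_copy (1 : MPPerm μ) k 1 (f := fun _ => ())
    measurable_const
  have hmp : MeasurePreserving (fun x => (π x).1) μ (ProbabilityTheory.uniformOn Set.univ) :=
    measurePreserving_fst.comp hπ
  refine ⟨fun x => (π x).1, hmp.measurable, ?_⟩
  have hcell : ∀ v : Fin k, μ.real ((fun x => (π x).1) ⁻¹' {v}) = (k : ℝ)⁻¹ := fun v => by
    rw [hmp.measureReal_preimage (measurableSet_singleton v).nullMeasurableSet, measureReal_def,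
      ProbabilityTheory.uniformOn_univ, Measure.count_singleton]
    simp
  have hk : (k : ℝ) ≠ 0 := by exact_mod_cast NeZero.ne k
  unfold partEntropy
  simp only [hcell, Finset.sum_const, Finset.card_univ, Fintype.card_fin, nsmul_eq_mul,
    Real.negMulLog, Real.log_inv]
  field_simp

/-- An approximation of `T` on the first `n` sets of the family for which the partitions `Sᵖ ξ`,
`p` in the progression, are independent. -/
theorem exists_halmosTerm_le {A : ℕ → Set X} (hA : ∀ i, MeasurableSet (A i)) (T : MPPerm μ)
    (L : ℕ → ℕ) (j : ℕ) [NeZero j] [NeZero (L j)] {k : ℕ} {ξ : X → Fin k} (hξ : Measurable ξ)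
    (n : ℕ) :
    ∃ S : MPPerm μ, (∀ i < n, halmosTerm μ (A i) T S ≤ 2 / j) ∧
      partEntropy μ (joinPartition S (progression L j) ξ) = L j * partEntropy μ ξ := by
  -- Both halves of the Halmos term become relations between f x and f (S x). Membership of T x in
  -- `A i`, read at x, is compared with membership of S x, read at S x; membership of x is compared
  -- with that of T⁻¹(S x), read at S x. For S = T neither comparison can fail.
  let f : X → Fin k × (Fin n → Prop × Prop × Prop) := fun x =>
    (ξ x, fun i => (x ∈ A i, T.1 x ∈ A i, (T⁻¹).1 x ∈ A i))
  have hf : Measurable f := by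
    refine hξ.prodMk (measurable_pi_lambda _ fun i => ?_)
    refine Measurable.prodMk ?_ (Measurable.prodMk ?_ ?_)
    · exact measurableSet_setOfPred.1 (hA i)
    · exact measurableSet_setOfPred.1 (T.2.1.measurable (hA i))
    · exact measurableSet_setOfPred.1 (T.2.2.measurable (hA i))
  obtain ⟨S, hS, hent⟩ := exists_approx T L j hf Prod.fst
  refine ⟨S, fun i hi => ?_, hent⟩
  have h1 : μ.real ((⇑T.1 '' A i) ∆ (⇑S.1 '' A i)) ≤ 1 / j := by
    have h2 := hS (fun a b => ¬ ((b.2 ⟨i, hi⟩).2.2 ↔ (a.2 ⟨i, hi⟩).1)) fun x hx => hx (by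
      change (T⁻¹).1 (T.1 x) ∈ A i ↔ x ∈ A i
      rw [show (T⁻¹).1 (T.1 x) = x from T.1.symm_apply_apply x])
    refine le_trans (le_of_eq ?_) h2
    rw [image_eq_preimage_inv, image_eq_preimage_inv, ← S.2.1.measureReal_preimage
      (((T⁻¹).2.1.measurable (hA i)).symmDiff ((S⁻¹).2.1.measurable (hA i))).nullMeasurableSet]
    congr 1
    ext x
    have h3 : (S⁻¹).1 (S.1 x) = x := S.1.symm_apply_apply x
    simp only [Set.mem_preimage, Set.mem_symmDiff]
    change ((T⁻¹).1 (S.1 x) ∈ A i ∧ (S⁻¹).1 (S.1 x) ∉ A i ∨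
      (S⁻¹).1 (S.1 x) ∈ A i ∧ (T⁻¹).1 (S.1 x) ∉ A i) ↔ ¬ ((T⁻¹).1 (S.1 x) ∈ A i ↔ x ∈ A i)
    rw [h3]
    tauto
  have h4 : μ.real ((⇑(T⁻¹).1 '' A i) ∆ (⇑(S⁻¹).1 '' A i)) ≤ 1 / j := by
    have h2 := hS (fun a b => ¬ ((a.2 ⟨i, hi⟩).2.1 ↔ (b.2 ⟨i, hi⟩).1)) fun x hx => hx Iff.rfl
    refine le_trans (le_of_eq ?_) h2
    rw [image_inv_eq_preimage, image_inv_eq_preimage]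
    congr 1
    ext x
    simp only [Set.mem_preimage, Set.mem_symmDiff]
    change _ ↔ ¬ (T.1 x ∈ A i ↔ S.1 x ∈ A i)
    tauto
  calc halmosTerm μ (A i) T S ≤ 1 / j + 1 / j := add_le_add h1 h4
    _ = 2 / j := by ring

theorem exists_halmosDist_lt {A : ℕ → Set X} (hA : ∀ i, MeasurableSet (A i)) (T : MPPerm μ)
    {L : ℕ → ℕ} (hL : Tendsto L atTop atTop) {k : ℕ} {ξ : X → Fin k} (hξ : Measurable ξ)
    (n : ℕ) {ε : ℝ} (hε : 0 < ε) :
    ∃ j ≥ n, ∃ S : MPPerm μ, halmosDist μ A T S < ε ∧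
      partEntropy μ (joinPartition S (progression L j) ξ) / ((progression L j).card : ℝ) =
        partEntropy μ ξ := by
  obtain ⟨N, hN⟩ := eventually_atTop.1 (hL.eventually_ge_atTop 1)
  -- In j = n + N + m + 1 the term n gives j ≥ n, N gives L(j) ≥ 1, the 1 gives j > 0, and m → ∞
  -- controls more and more sets with error tending to 0.
  have hex : ∀ m : ℕ, ∃ S : MPPerm μ,
      (∀ i < m, halmosTerm μ (A i) T S ≤ 2 / ((n + N + m + 1 : ℕ) : ℝ)) ∧
      partEntropy μ (joinPartition S (progression L (n + N + m + 1)) ξ) /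
        ((progression L (n + N + m + 1)).card : ℝ) = partEntropy μ ξ := by
    intro m
    have hpos : L (n + N + m + 1) ≠ 0 := by
      have := hN (n + N + m + 1) (by omega)
      omega
    have : NeZero (L (n + N + m + 1)) := ⟨hpos⟩
    obtain ⟨S, hS, hent⟩ := exists_halmosTerm_le hA T L (n + N + m + 1) hξ m
    refine ⟨S, hS, ?_⟩
    rw [hent, card_progression]
    exact mul_div_cancel_left₀ _ (by exact_mod_cast hpos)
  choose S hS hent using hex
  have hlim : Tendsto (fun m => halmosDist μ A T (S m)) atTop (𝓝 0) := by
    refine tendsto_halmosDist fun i => ?_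
    refine squeeze_zero' (Eventually.of_forall fun _ => halmosTerm_nonneg _ _ _)
      (g := fun m : ℕ => 2 / (m : ℝ)) ?_ (tendsto_const_div_atTop_nhds_zero_nat 2)
    filter_upwards [eventually_gt_atTop i] with m hm
    refine (hS m i hm).trans ?_
    have hm0 : (0 : ℝ) < m := by exact_mod_cast (Nat.zero_le i).trans_lt hm
    gcongr
    omega
  obtain ⟨m, hm⟩ := (hlim.eventually (gt_mem_nhds hε)).exists
  exact ⟨n + N + m + 1, by omega, S m, hm, hent m⟩

end Density

/-! ### Infinite entropy from infinitely many large values, and the category argument. -/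

section Typical

variable {X : Type*} [MeasurableSpace X]

theorem pEntropy_eq_top {μ : Measure X} {P : ℕ → Finset ℤ} {S : Aut μ}
    (h : ∀ M : ℕ, ∃ (k : ℕ) (ξ : X → Fin k), Measurable ξ ∧
      ∀ n : ℕ, ∃ j ≥ n, (M : ℝ) < joinEntropy S (P j) ξ / ((P j).card : ℝ)) :
    pEntropy P S = ⊤ := by
  refine EReal.eq_top_iff_forall_lt _ |>.2 fun y => ?_
  obtain ⟨M, hM⟩ := exists_nat_gt y
  obtain ⟨k, ξ, hξ, hfreq⟩ := h M
  have h1 : ((M : ℝ) : EReal) ≤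
      limsup (fun j => ((joinEntropy S (P j) ξ / ((P j).card : ℝ) : ℝ) : EReal)) atTop := by
    refine le_limsup_of_frequently_le' (frequently_atTop.2 fun n => ?_)
    obtain ⟨j, hj, hlt⟩ := hfreq n
    exact ⟨j, hj, EReal.coe_le_coe_iff.2 hlt.le⟩
  refine (EReal.coe_lt_coe_iff.2 hM).trans_le (h1.trans ?_)
  exact le_iSup_of_le k (le_iSup_of_le ξ (le_iSup_of_le hξ le_rfl))

end Typical

end PEntropy

theorem theorem7p1 {X : Type*} [MeasurableSpace X] [StandardBorelSpace X]
    (μ : MeasureTheory.Measure X) [MeasureTheory.IsProbabilityMeasure μ]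
    [MeasureTheory.NullSingletonClass μ]
    (A : ℕ → Set X) (hA : PEntropy.IsDenseFamily μ A)
    (L : ℕ → ℕ) (hL : Filter.Tendsto L Filter.atTop Filter.atTop) :
    letI := PEntropy.halmosMetric μ hA
    PEntropy.IsTypical
      {S : PEntropy.Aut μ | PEntropy.pEntropy (PEntropy.progression L) S = ⊤} := by
  let _ := PEntropy.halmosMetric μ hA
  have hξ : ∀ M : ℕ, ∃ (k : ℕ) (ξ : X → Fin k), Measurable ξ ∧
      (M : ℝ) < PEntropy.partEntropy μ ξ := by
    intro M
    -- k equal cells have entropy log k, which exceeds M once k > e^M.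
    obtain ⟨k, hk⟩ := exists_nat_gt (Real.exp M)
    have hk0 : (0 : ℝ) < k := (Real.exp_pos _).trans hk
    have : NeZero k := ⟨by rintro rfl; simp at hk0⟩
    obtain ⟨ξ, hξ, hent⟩ := PEntropy.exists_partEntropy_eq_log μ k
    exact ⟨k, ξ, hξ, by rw [hent]; exact (Real.lt_log_iff_exp_lt hk0).2 hk⟩
  choose k ξ hξm hξM using hξ
  let U : ℕ → ℕ → Set (PEntropy.Aut μ) := fun M n => {S | ∃ j ≥ n, (M : ℝ) <
    PEntropy.joinEntropy S (PEntropy.progression L j) (ξ M) /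
      ((PEntropy.progression L j).card : ℝ)}
  have hopen : ∀ M n, IsOpen (U M n) := by
    intro M n
    have hU : U M n = ⋃ j, ⋃ (_ : j ≥ n), {S | (M : ℝ) <
        PEntropy.joinEntropy S (PEntropy.progression L j) (ξ M) /
          ((PEntropy.progression L j).card : ℝ)} := by
      ext S
      simp [U]
    rw [hU]
    exact isOpen_iUnion fun j => isOpen_iUnion fun _ => isOpen_lt continuous_const
      ((PEntropy.continuous_joinEntropy hA _ (hξm M)).div_const _)
  have hdense : ∀ M n, Dense (U M n) := by
    intro M n
    refine Metric.dense_iff.2 fun T r hr => ?_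
    induction T using Con.induction_on with | _ T
    obtain ⟨j, hj, S, hdist, hent⟩ := PEntropy.exists_halmosDist_lt hA.1 T hL (hξm M) n hr
    refine ⟨(S : PEntropy.Aut μ), ?_, j, hj, (hξM M).trans_eq hent.symm⟩
    rw [Metric.mem_ball']
    exact hdist
  unfold PEntropy.IsTypical IsMeagre
  rw [compl_compl]
  have hres : (⋂ M, ⋂ n, U M n) ∈ residual (PEntropy.Aut μ) :=
    countable_iInter_mem.2 fun M => countable_iInter_mem.2 fun n =>
      residual_of_dense_open (hopen M n) (hdense M n)
  refine mem_of_superset hres fun S hS => ?_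
  refine PEntropy.pEntropy_eq_top fun M => ⟨k M, ξ M, hξm M, fun n => ?_⟩
  exact Set.mem_iInter.1 (Set.mem_iInter.1 hS M) n
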